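/- For integers $0\le s\le n$ let $Y=Y_{n,s}$ be the number of draws needed to collect all of $n$ coupons, when each draw yields a package, i.e. a uniformly random $s$-element subset of the $n$ coupons, and different draws are independent. Let $t\ge 2$ be a fixed integer and let $s=s(n)$ be a sequence of integers with $0\le s(n)\le n$. (a) Let $\lambda>0$ be fixed and suppose that $s(n)=n-\lambda n^{(t-1)/t}$ up to rounding, i.e. $\left|s(n)-\left(n-\lambda n^{(t-1)/t}\right)\right|\le 1$ for all sufficiently large $n$. Then, for all sufficiently large $n$, $Y$ is almost surely finite, and $$\lim_{n\to\infty}\mathbb E[Y]=t\,e^{-\lambda^t}+(t+1)\left(1-e^{-\lambda^t}\right).$$ Moreover, $Y$ converges in distribution to $Z$ as $n\to\infty$, where $Z$ is a random variable with $\mathbb P[Z=t]=e^{-\lambda^t}$ and $\mathbb P[Z=t+1]=1-e^{-\lambda^t}$. (b) Suppose that $n-s(n)=o\left(n^{t/(t+1)}\right)$ and $n-s(n)=\omega\left(n^{(t-1)/t}\right)$, i.e. $(n-s(n))/n^{(t-1)/t}\to\infty$, as $n\to\infty$. Then, for all sufficiently large $n$, $Y$ is almost surely finite, and $$\lim_{n\to\infty}\mathbb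 E[Y]=t+1.$$ Moreover, $Y\to t+1$ in probability as $n\to\infty$, i.e. $\lim_{n\to\infty}\mathbb P[|Y-(t+1)|>\varepsilon]=0$ for every $\varepsilon>0$. -/

import Mathlib

open MeasureTheory ProbabilityTheory Filter Topology Asymptotics
open scoped ENNReal

/-- `D 0, D 1, D 2, …` are independent uniformly distributed random `s`-element subsets (packages)
of a set of `n` coupons: every package has size `s`, each of the `n.choose s` possible packages
being equally likely. Events on the finite set of packages are all its subsets. -/
structure IsUniformGroupDrawing {Ω : Type*} [MeasurableSpace Ω] (μ : Measure Ω) (n s : ℕ)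
    (D : ℕ → Ω → Finset (Fin n)) : Prop where
  measurable : ∀ k, Measurable[_, ⊤] (D k)
  law : ∀ (k : ℕ) (A : Finset (Fin n)),
    μ {ω | D k ω = A} = if A.card = s then ((n.choose s : ℕ) : ℝ≥0∞)⁻¹ else 0
  indep : iIndepFun (m := fun _ => ⊤) D μ

/-- The number of draws required to collect all coupons: the least `k` such that each coupon lies
in one of the first `k` packages, and `⊤` if the collection is never completed. -/
noncomputable def collectionTime {Ω : Type*} {n : ℕ} (D : ℕ → Ω → Finset (Fin n)) (ω : Ω) : ℕ∞ :=
  ⨅ (k : ℕ) (_ : ∀ c : Fin n, ∃ j < k, c ∈ D j ω), (k : ℕ∞)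

/-- The number of draws as a real number (it is only of interest where it is finite). -/
noncomputable def realCollectionTime {Ω : Type*} {n : ℕ} (D : ℕ → Ω → Finset (Fin n)) (ω : Ω) : ℝ :=
  ((collectionTime D ω).toNat : ℝ)

/-- The expected number of draws, with values in `[0, ∞]`. -/
noncomputable def expectedCollectionTime {Ω : Type*} [MeasurableSpace Ω] (μ : Measure Ω) {n : ℕ}
    (D : ℕ → Ω → Finset (Fin n)) : ℝ≥0∞ :=
  ∫⁻ ω, ((collectionTime D ω : ℕ∞) : ℝ≥0∞) ∂μ

/-! Put `r = n - s` and `m_k = n (r/n)^k`, the expected number of coupons missed by `k` draws, and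
let `p_k = P[Y > k]`. A fixed set of `j` coupons is missed by `k` draws with probability
`((r)_j/(n)_j)^k`, where `(·)_j` is the falling factorial.

Everything depends on the limit of `m_k`. If `m_k → 0`, the union bound gives `p_k → 0`. If `m_k →
∞`, negative correlation and Chebyshev give `p_k → 1` (`mean_mul_one_sub_incompleteProb_le`). If
`m_k → L` and `r → ∞`, the inclusion–exclusion sum for `1 - p_k` tends to the series of `exp (-L)`
(`tendsto_alternating_sum`), a Poisson limit.

In (a), `m_{t-1} → ∞`, `m_t → λ^t` and `m_{t+1} → 0`; in (b), `m_t → ∞` and `m_{t+1} → 0`. This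
determines the limit law of `Y`. Since `E[Y] = ∑ p_k`, the expectation follows once the terms beyond
`t` are dominated by a geometric series of sum at most `2 m_{t+1}`. -/

/-! ### Binomial ratios and falling factorials -/

theorem choose_sub_mul_descFactorial (n s j : ℕ) :
    (n - j).choose s * n.descFactorial j = (n - s).descFactorial j * n.choose s := by
  have h1 : (n - j).descFactorial s * n.descFactorial j = n.descFactorial (j + s) := by
    have := Nat.descFactorial_mul_descFactorial (n := n) (Nat.le_add_right j s)
    simpa using this
  have h2 : (n - s).descFactorial j * n.descFactorial s = n.descFactorial (j + s) := by
    have := Nat.descFactorial_mul_descFactorial (n := n) (Nat.le_add_left s j)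
    simpa using this
  rw [Nat.descFactorial_eq_factorial_mul_choose _ s] at h1 h2
  apply Nat.eq_of_mul_eq_mul_left (Nat.factorial_pos s)
  linarith

/-- The left side is the chance that one package avoids `j` given coupons. The right side puts `j`
in the number of factors, which suits estimates and limits for fixed `j`. -/
theorem choose_sub_div_choose {n s j : ℕ} (hs : s ≤ n) (hj : j ≤ n) :
    ((n - j).choose s : ℝ) / n.choose s = ((n - s).descFactorial j : ℝ) / n.descFactorial j := by
  have h1 : (n.choose s : ℝ) ≠ 0 := by exact_mod_cast (Nat.choose_pos hs).ne'
  have h2 : (n.descFactorial j : ℝ) ≠ 0 := by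
    exact_mod_cast (Nat.descFactorial_pos.2 hj).ne'
  rw [div_eq_div_iff h1 h2]
  exact_mod_cast choose_sub_mul_descFactorial n s j

/-- Factor by factor, `(r - i)/(n - i) ≤ r/n`. This is the source of negative correlation between
missed coupons. -/
theorem descFactorial_mul_pow_le {r n : ℕ} (h : r ≤ n) (j : ℕ) :
    r.descFactorial j * n ^ j ≤ r ^ j * n.descFactorial j := by
  induction j with
  | zero => simp
  | succ j ih =>
    have h1 : (r - j) * n ≤ r * (n - j) := by
      rw [Nat.sub_mul, Nat.mul_sub]
      have : r * j ≤ j * n := by rw [mul_comm]; exact Nat.mul_le_mul_left _ h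
      omega
    calc r.descFactorial (j + 1) * n ^ (j + 1)
        = ((r - j) * n) * (r.descFactorial j * n ^ j) := by
          rw [Nat.descFactorial_succ]; ring
      _ ≤ (r * (n - j)) * (r ^ j * n.descFactorial j) := Nat.mul_le_mul h1 ih
      _ = r ^ (j + 1) * n.descFactorial (j + 1) := by rw [Nat.descFactorial_succ]; ring

theorem descFactorial_div_le {r n j : ℕ} (h : r ≤ n) (hj : j ≤ n) :
    (r.descFactorial j : ℝ) / n.descFactorial j ≤ ((r : ℝ) / n) ^ j := by
  rcases Nat.eq_zero_or_pos n with rfl | hn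
  · obtain rfl : j = 0 := by omega
    simp
  have h2 : 0 < (n.descFactorial j : ℝ) := by
    exact_mod_cast Nat.descFactorial_pos.2 hj
  have hn' : 0 < (n : ℝ) := by exact_mod_cast hn
  rw [div_pow, div_le_div_iff₀ h2 (by positivity)]
  exact_mod_cast descFactorial_mul_pow_le h j

/-! ### Missed coupons and the collection time -/

/-- The event that no coupon of `S` occurs in the first `k` packages. -/
def missedEvent {Ω : Type*} {n : ℕ} (D : ℕ → Ω → Finset (Fin n)) (k : ℕ) (S : Finset (Fin n)) :
    Set Ω :=
  {ω | ∀ c ∈ S, ∀ j < k, c ∉ D j ω}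

theorem collectionTime_le_iff {Ω : Type*} {n : ℕ} {D : ℕ → Ω → Finset (Fin n)} {ω : Ω} {k : ℕ} :
    collectionTime D ω ≤ k ↔ ∀ c : Fin n, ∃ j < k, c ∈ D j ω := by
  constructor
  · intro h
    -- A strict bound on an infimum yields a witness, hence the passage to `k + 1`.
    have h' : collectionTime D ω < ((k + 1 : ℕ) : ℕ∞) :=
      lt_of_le_of_lt h (by exact_mod_cast Nat.lt_succ_self k)
    simp only [collectionTime, iInf_lt_iff] at h'
    obtain ⟨l, hl, hlk⟩ := h'
    have hlk' : l < k + 1 := by exact_mod_cast hlk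
    intro c
    obtain ⟨j, hj, hc⟩ := hl c
    exact ⟨j, by omega, hc⟩
  · intro h
    exact iInf₂_le k h

theorem lt_collectionTime_iff {Ω : Type*} {n : ℕ} {D : ℕ → Ω → Finset (Fin n)} {ω : Ω} {k : ℕ} :
    (k : ℕ∞) < collectionTime D ω ↔ ∃ c : Fin n, ω ∈ missedEvent D k {c} := by
  rw [← not_le, collectionTime_le_iff]
  simp [missedEvent]

theorem missedEvent_eq_iInter {Ω : Type*} {n : ℕ} (D : ℕ → Ω → Finset (Fin n)) (k : ℕ) (S : Finset (Fin n)) :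
    missedEvent D k S = ⋂ j ∈ Finset.range k, D j ⁻¹' {A | Disjoint A S} := by
  ext ω
  simp only [missedEvent, Set.mem_ofPred_eq, Finset.mem_range, Set.mem_iInter, Set.mem_preimage,
    Finset.disjoint_right]
  exact ⟨fun h j hj c hc => h c hc j hj, fun h c hc j hj => h j hj hc⟩

theorem prod_one_sub_indicator {Ω : Type*} {n : ℕ} (D : ℕ → Ω → Finset (Fin n)) (k : ℕ) (ω : Ω) :
    ∏ c : Fin n, (1 - (missedEvent D k {c}).indicator (1 : Ω → ℝ) ω) =
      {ω | (k : ℕ∞) < collectionTime D ω}ᶜ.indicator 1 ω := by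
  by_cases hω : (k : ℕ∞) < collectionTime D ω
  · obtain ⟨c, hc⟩ := lt_collectionTime_iff.1 hω
    rw [Set.indicator_of_notMem (by simpa using hω)]
    exact Finset.prod_eq_zero (Finset.mem_univ c) (by simp [hc])
  · rw [Set.indicator_of_mem (by simpa using hω)]
    rw [lt_collectionTime_iff] at hω
    push Not at hω
    exact Finset.prod_eq_one fun c _ => by simp [hω c]

theorem prod_indicator_missedEvent {Ω : Type*} {n : ℕ} (D : ℕ → Ω → Finset (Fin n)) (k : ℕ) (S : Finset (Fin n))
    (ω : Ω) :
    ∏ c ∈ S, (missedEvent D k {c}).indicator (1 : Ω → ℝ) ω =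
      (missedEvent D k S).indicator 1 ω := by
  by_cases hω : ω ∈ missedEvent D k S
  · rw [Set.indicator_of_mem hω]
    refine Finset.prod_eq_one fun c hc => Set.indicator_of_mem ?_ _
    intro d hd j hj
    rw [Finset.mem_singleton.1 hd]
    exact hω c hc j hj
  · rw [Set.indicator_of_notMem hω]
    have : ∃ c ∈ S, ω ∉ missedEvent D k {c} := by
      simp only [missedEvent, Set.mem_ofPred_eq] at hω ⊢
      push Not at hω ⊢
      obtain ⟨c, hc, j, hj, hcj⟩ := hω
      exact ⟨c, hc, c, by simp, j, hj, hcj⟩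
    obtain ⟨c, hc, hc'⟩ := this
    exact Finset.prod_eq_zero hc (Set.indicator_of_notMem hc' _)

/-- The probability that the collection is incomplete after `k` draws. -/
noncomputable def incompleteProb {Ω : Type*} [MeasurableSpace Ω] (μ : Measure Ω) {n : ℕ}
    (D : ℕ → Ω → Finset (Fin n)) (k : ℕ) : ℝ :=
  μ.real {ω | (k : ℕ∞) < collectionTime D ω}

/-! ### Measurability, inclusion–exclusion and moment bounds -/

section Drawing

variable {Ω : Type*} [MeasurableSpace Ω] {μ : Measure Ω} {n s : ℕ} {D : ℕ → Ω → Finset (Fin n)}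

namespace IsUniformGroupDrawing

theorem measurableSet_missedEvent (h : IsUniformGroupDrawing μ n s D) (k : ℕ)
    (S : Finset (Fin n)) : MeasurableSet (missedEvent D k S) := by
  rw [missedEvent_eq_iInter]
  exact Finset.measurableSet_biInter _ fun j _ => h.measurable j trivial

theorem measurable_collectionTime (h : IsUniformGroupDrawing μ n s D) :
    Measurable (collectionTime D) := by
  have hlt : ∀ k : ℕ, MeasurableSet {ω | (k : ℕ∞) < collectionTime D ω} := fun k => by
    have : {ω | (k : ℕ∞) < collectionTime D ω} = ⋃ c : Fin n, missedEvent D k {c} := by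
      ext ω; simp [lt_collectionTime_iff]
    rw [this]
    exact MeasurableSet.iUnion fun c => h.measurableSet_missedEvent k {c}
  rw [ENat.measurable_iff]
  intro k
  have : collectionTime D ⁻¹' {(k : ℕ∞)} = {ω | (k : ℕ∞) < collectionTime D ω}ᶜ ∩
      ⋂ l ∈ Finset.range k, {ω | (l : ℕ∞) < collectionTime D ω} := by
    ext ω
    simp only [Set.mem_preimage, Set.mem_singleton_iff, Set.mem_inter_iff, Set.mem_compl_iff,
      Set.mem_ofPred_eq, not_lt, Set.mem_iInter, Finset.mem_range]
    constructor
    · intro he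
      exact ⟨he.le, fun l hl => by rw [he]; exact_mod_cast hl⟩
    · rintro ⟨h1, h2⟩
      refine le_antisymm h1 ?_
      rcases k with _ | k
      · simp
      · have := h2 k (Nat.lt_succ_self k)
        simpa using Order.add_one_le_of_lt this
  rw [this]
  exact (hlt k).compl.inter (Finset.measurableSet_biInter _ fun l _ => hlt l)

theorem measurableSet_lt_collectionTime (h : IsUniformGroupDrawing μ n s D) (x : ℕ∞) :
    MeasurableSet {ω | x < collectionTime D ω} :=
  h.measurable_collectionTime (MeasurableSet.of_discrete (s := Set.Ioi x))

theorem measurable_realCollectionTime (h : IsUniformGroupDrawing μ n s D) :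
    Measurable (realCollectionTime D) :=
  (Measurable.of_discrete (f := fun x : ℕ∞ => ((x.toNat : ℕ) : ℝ))).comp
    h.measurable_collectionTime

theorem measure_disjoint (h : IsUniformGroupDrawing μ n s D) (j : ℕ) (S : Finset (Fin n)) :
    μ (D j ⁻¹' {A | Disjoint A S}) = ((n - S.card).choose s : ℝ≥0∞) * (n.choose s : ℝ≥0∞)⁻¹ := by
  classical
  have hunion : D j ⁻¹' {A | Disjoint A S} =
      ⋃ A ∈ Finset.univ.filter (fun A : Finset (Fin n) => Disjoint A S), D j ⁻¹' {A} := by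
    ext ω; simp
  rw [hunion, measure_biUnion_finset]
  · have hlaw : ∀ A : Finset (Fin n), μ (D j ⁻¹' {A}) =
        if A.card = s then ((n.choose s : ℕ) : ℝ≥0∞)⁻¹ else 0 := fun A => h.law j A
    simp_rw [hlaw]
    rw [← Finset.sum_filter, Finset.sum_const, nsmul_eq_mul]
    congr 2
    have : (Finset.univ.filter (fun A : Finset (Fin n) => Disjoint A S)).filter
        (fun A => A.card = s) = Finset.powersetCard s Sᶜ := by
      ext A
      simp [Finset.mem_powersetCard, Finset.subset_compl_iff_disjoint_right]
    rw [this, Finset.card_powersetCard, Finset.card_compl, Fintype.card_fin]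
  · intro A _ B _ hAB
    exact Disjoint.preimage _ (by simpa using hAB)
  · exact fun A _ => h.measurable j trivial

theorem card_le [IsProbabilityMeasure μ] (h : IsUniformGroupDrawing μ n s D) : s ≤ n := by
  by_contra hs
  -- Disjointness from `∅` is the sure event, so `s > n` would give `1 = 0 * 0⁻¹ = 0` in `ℝ≥0∞`.
  have h1 := h.measure_disjoint 0 ∅
  have : (n.choose s) = 0 := Nat.choose_eq_zero_of_lt (by omega)
  simp [this] at h1

theorem measureReal_missedEvent [IsProbabilityMeasure μ] (h : IsUniformGroupDrawing μ n s D)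
    (k : ℕ) (S : Finset (Fin n)) :
    μ.real (missedEvent D k S) =
      (((n - s).descFactorial S.card : ℝ) / n.descFactorial S.card) ^ k := by
  have hS : S.card ≤ n := by simpa using S.card_le_univ
  rw [← choose_sub_div_choose h.card_le hS, missedEvent_eq_iInter, Measure.real,
    (iIndepFun_iff_measure_inter_preimage_eq_mul.1 h.indep) _ (fun _ _ => trivial)]
  simp_rw [h.measure_disjoint]
  simp [ENNReal.toReal_mul, ENNReal.toReal_inv, div_eq_mul_inv]

theorem incompleteProb_le [IsProbabilityMeasure μ] (h : IsUniformGroupDrawing μ n s D) (k : ℕ) :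
    incompleteProb μ D k ≤ n * (((n - s : ℕ) : ℝ) / n) ^ k := by
  have : {ω | (k : ℕ∞) < collectionTime D ω} = ⋃ c : Fin n, missedEvent D k {c} := by
    ext ω; simp [lt_collectionTime_iff]
  rw [incompleteProb, this]
  refine (measureReal_iUnion_fintype_le _).trans ?_
  simp [h.measureReal_missedEvent]

theorem incompleteProb_antitone [IsProbabilityMeasure μ] (D : ℕ → Ω → Finset (Fin n)) :
    Antitone (incompleteProb μ D) := by
  intro k l hkl
  refine measureReal_mono fun ω (hω : (l : ℕ∞) < _) => ?_
  exact lt_of_le_of_lt (by exact_mod_cast hkl) hω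

/-- Inclusion–exclusion for the probability that the collection is complete after `k` draws. -/
theorem one_sub_incompleteProb [IsProbabilityMeasure μ] (h : IsUniformGroupDrawing μ n s D)
    (k : ℕ) :
    1 - incompleteProb μ D k = ∑ j ∈ Finset.range (n + 1), (-1 : ℝ) ^ j * n.choose j *
      (((n - s).descFactorial j : ℝ) / n.descFactorial j) ^ k := by
  classical
  have hm := h.measurableSet_lt_collectionTime k
  rw [incompleteProb, ← probReal_compl_eq_one_sub hm, ← integral_indicator_one hm.compl]
  simp_rw [← prod_one_sub_indicator D k, sub_eq_add_neg, Finset.prod_one_add, Finset.prod_neg,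
    prod_indicator_missedEvent]
  rw [integral_finsetSum]
  · simp_rw [integral_const_mul, integral_indicator_one (h.measurableSet_missedEvent k _),
      h.measureReal_missedEvent]
    rw [Finset.sum_powerset_apply_card
      (fun j => (-1 : ℝ) ^ j * (((n - s).descFactorial j : ℝ) / n.descFactorial j) ^ k)]
    simp only [Finset.card_univ, Fintype.card_fin, nsmul_eq_mul]
    exact Finset.sum_congr rfl fun j _ => by ring
  · intro S _
    exact ((integrable_const (1 : ℝ)).indicator (h.measurableSet_missedEvent k S)).const_mul _

/-- Second moment bound: the numbers of missed coupons are negatively correlated. -/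
theorem mean_mul_one_sub_incompleteProb_le [IsProbabilityMeasure μ]
    (h : IsUniformGroupDrawing μ n s D) (k : ℕ) :
    (n * (((n - s : ℕ) : ℝ) / n) ^ k) * (1 - incompleteProb μ D k) ≤ 1 := by
  classical
  set m : ℝ := n * (((n - s : ℕ) : ℝ) / n) ^ k with hm
  set X : Ω → ℝ := fun ω => ∑ c : Fin n, (missedEvent D k {c}).indicator (1 : Ω → ℝ) ω with hX
  have hint : ∀ S, Integrable ((missedEvent D k S).indicator (1 : Ω → ℝ)) μ := fun S =>
    (integrable_const (1 : ℝ)).indicator (h.measurableSet_missedEvent k S)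
  have hval : ∀ S, ∫ ω, (missedEvent D k S).indicator (1 : Ω → ℝ) ω ∂μ =
      (((n - s).descFactorial S.card : ℝ) / n.descFactorial S.card) ^ k := fun S => by
    rw [integral_indicator_one (h.measurableSet_missedEvent k S), h.measureReal_missedEvent]
  have hXint : Integrable X μ := integrable_finsetSum _ fun c _ => hint {c}
  have hXmean : ∫ ω, X ω ∂μ = m := by
    simp only [hX]
    rw [integral_finsetSum _ fun c _ => hint {c}]
    simp only [hval]
    simp [hm]
  have hpair : ∀ c d ω, (missedEvent D k {c}).indicator (1 : Ω → ℝ) ω *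
      (missedEvent D k {d}).indicator (1 : Ω → ℝ) ω =
      (missedEvent D k {c, d}).indicator (1 : Ω → ℝ) ω := fun c d ω => by
    by_cases hcd : c = d
    · subst hcd
      by_cases hc : ω ∈ missedEvent D k {c} <;> simp [hc]
    · rw [← prod_indicator_missedEvent D k {c, d}, Finset.prod_pair hcd]
  have hXsq : ∀ ω, X ω ^ 2 = ∑ c : Fin n, ∑ d : Fin n,
      (missedEvent D k {c, d}).indicator (1 : Ω → ℝ) ω := fun ω => by
    simp only [hX, sq, Finset.sum_mul_sum, hpair]
  have hXsqint : Integrable (fun ω => X ω ^ 2) μ := by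
    simp only [hXsq]
    exact integrable_finsetSum _ fun c _ => integrable_finsetSum _ fun d _ => hint _
  have hXsqmean : ∫ ω, X ω ^ 2 ∂μ ≤ m + m ^ 2 := by
    simp only [hXsq]
    rw [integral_finsetSum _ fun c _ => integrable_finsetSum _ fun d _ => hint _]
    set v : ℝ := (((n - s : ℕ) : ℝ) / n) ^ k with hv
    -- Allowing the superfluous `v ^ 2` on the diagonal makes the double sum exactly `n v + (n v)^2
    -- = m + m ^ 2`.
    have hbound : ∀ c d : Fin n, ∫ ω, (missedEvent D k {c, d}).indicator (1 : Ω → ℝ) ω ∂μ ≤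
        (if c = d then v else 0) + v ^ 2 := fun c d => by
      rw [hval]
      split_ifs with hcd
      · subst hcd
        simp only [Finset.insert_eq_of_mem (Finset.mem_singleton_self c), Finset.card_singleton,
          Nat.descFactorial_one]
        have := sq_nonneg v
        linarith
      · have hcard : ({c, d} : Finset (Fin n)).card = 2 := Finset.card_pair hcd
        have h2n : 2 ≤ n := by
          rw [← hcard]; simpa using ({c, d} : Finset (Fin n)).card_le_univ
        rw [hcard, zero_add, hv, ← pow_mul, mul_comm k 2, pow_mul]
        exact pow_le_pow_left₀ (by positivity) (descFactorial_div_le (Nat.sub_le _ _) h2n) k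
    calc ∑ c : Fin n, ∫ ω, ∑ d : Fin n,
          (missedEvent D k {c, d}).indicator (1 : Ω → ℝ) ω ∂μ
        = ∑ c : Fin n, ∑ d : Fin n,
          ∫ ω, (missedEvent D k {c, d}).indicator (1 : Ω → ℝ) ω ∂μ :=
          Finset.sum_congr rfl fun c _ => integral_finsetSum _ fun d _ => hint _
      _ ≤ ∑ c : Fin n, ∑ d : Fin n, ((if c = d then v else 0) + v ^ 2) :=
          Finset.sum_le_sum fun c _ => Finset.sum_le_sum fun d _ => hbound c d
      _ = m + m ^ 2 := by
          simp [Finset.sum_add_distrib, hm]; ring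
  have hmnn : 0 ≤ m := by positivity
  have hms := h.measurableSet_lt_collectionTime k
  -- Chebyshev: `X = 0` when the collection is complete, so `m ^ 2` times that indicator is at most
  -- `(X - m) ^ 2`, whose mean is the variance, at most `m`.
  have hkey : m ^ 2 * (1 - incompleteProb μ D k) ≤ m := by
    calc m ^ 2 * (1 - incompleteProb μ D k)
        = ∫ ω, m ^ 2 * {ω | (k : ℕ∞) < collectionTime D ω}ᶜ.indicator 1 ω ∂μ := by
          rw [integral_const_mul, integral_indicator_one hms.compl, incompleteProb,
            probReal_compl_eq_one_sub hms]
      _ ≤ ∫ ω, (X ω ^ 2 - 2 * m * X ω + m ^ 2) ∂μ := by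
          refine integral_mono (((integrable_const (1 : ℝ)).indicator hms.compl).const_mul _)
            ((hXsqint.sub (hXint.const_mul _)).add (integrable_const _)) fun ω => ?_
          by_cases hω : (k : ℕ∞) < collectionTime D ω
          · have : (0 : ℝ) ≤ (X ω - m) ^ 2 := sq_nonneg _
            simp only [Set.indicator_of_notMem
              (show ω ∉ {ω | (k : ℕ∞) < collectionTime D ω}ᶜ by simpa using hω)]
            nlinarith
          · have hX0 : X ω = 0 := by
              rw [lt_collectionTime_iff] at hω
              push Not at hω
              exact Finset.sum_eq_zero fun c _ => by simp [hω c]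
            simp only [Set.indicator_of_mem
              (show ω ∈ {ω | (k : ℕ∞) < collectionTime D ω}ᶜ by simpa using hω), hX0]
            simp
      _ = (∫ ω, X ω ^ 2 ∂μ) - 2 * m * m + m ^ 2 := by
          have h1 : ∫ ω, (X ω ^ 2 - 2 * m * X ω + m ^ 2) ∂μ =
              ∫ ω, (X ω ^ 2 - 2 * m * X ω) ∂μ + ∫ _, m ^ 2 ∂μ :=
            integral_add (hXsqint.sub (hXint.const_mul _)) (integrable_const _)
          have h2 : ∫ ω, (X ω ^ 2 - 2 * m * X ω) ∂μ =
              ∫ ω, X ω ^ 2 ∂μ - ∫ ω, 2 * m * X ω ∂μ :=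
            integral_sub hXsqint (hXint.const_mul _)
          rw [h1, h2, integral_const_mul, hXmean]
          simp
      _ ≤ m := by nlinarith
  rcases hmnn.eq_or_lt with h0 | hpos
  · rw [← h0]; simp
  · have : m * (m * (1 - incompleteProb μ D k)) ≤ m * 1 := by
      rw [mul_one]; calc _ = m ^ 2 * (1 - incompleteProb μ D k) := by ring
        _ ≤ m := hkey
    exact le_of_mul_le_mul_left this hpos

end IsUniformGroupDrawing

end Drawing

/-! ### Expectation as a sum of tail probabilities -/

theorem toENNReal_eq_tsum (x : ℕ∞) :
    (x : ℝ≥0∞) = ∑' k : ℕ, if (k : ℕ∞) < x then (1 : ℝ≥0∞) else 0 := by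
  induction x using ENat.recTopCoe with
  | top => simp
  | coe n =>
    rw [tsum_eq_sum (s := Finset.range n)]
    · rw [Finset.sum_congr rfl (g := fun _ => (1 : ℝ≥0∞))]
      · simp
      · intro k hk
        simp only [Nat.cast_lt, Finset.mem_range.1 hk, if_true]
    · intro k hk
      simpa using hk

section Drawing

variable {Ω : Type*} [MeasurableSpace Ω] {μ : Measure Ω} {n s : ℕ} {D : ℕ → Ω → Finset (Fin n)}

theorem incompleteProb_nonneg (k : ℕ) : 0 ≤ incompleteProb μ D k := measureReal_nonneg

theorem incompleteProb_le_one [IsProbabilityMeasure μ] (k : ℕ) : incompleteProb μ D k ≤ 1 :=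
  measureReal_le_one

theorem ofReal_incompleteProb [IsProbabilityMeasure μ] (k : ℕ) :
    ENNReal.ofReal (incompleteProb μ D k) = μ {ω | (k : ℕ∞) < collectionTime D ω} :=
  ofReal_measureReal

namespace IsUniformGroupDrawing

theorem expectedCollectionTime_eq_tsum [IsProbabilityMeasure μ]
    (h : IsUniformGroupDrawing μ n s D) :
    expectedCollectionTime μ D = ∑' k, ENNReal.ofReal (incompleteProb μ D k) := by
  have hind : ∀ (k : ℕ) ω, (if (k : ℕ∞) < collectionTime D ω then (1 : ℝ≥0∞) else 0) =
      {ω | (k : ℕ∞) < collectionTime D ω}.indicator 1 ω := fun k ω => by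
    simp [Set.indicator_apply]
  simp only [expectedCollectionTime, toENNReal_eq_tsum (collectionTime D _), hind]
  rw [lintegral_tsum fun k : ℕ =>
    (measurable_one.indicator (h.measurableSet_lt_collectionTime k)).aemeasurable]
  simp [lintegral_indicator_one (h.measurableSet_lt_collectionTime _), ofReal_incompleteProb]

/-- The union bound gives `p_{k+l} ≤ m_l (r/n)^k ≤ m_l 2^{-k}`, a geometric series. -/
theorem tsum_incompleteProb_add_le [IsProbabilityMeasure μ] (h : IsUniformGroupDrawing μ n s D)
    (hr : ((n - s : ℕ) : ℝ) / n ≤ 2⁻¹) (l : ℕ) :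
    ∑' k, ENNReal.ofReal (incompleteProb μ D (k + l)) ≤
      ENNReal.ofReal (n * (((n - s : ℕ) : ℝ) / n) ^ l) * 2 := by
  rw [← ENNReal.tsum_geometric_two, ← ENNReal.tsum_mul_left]
  refine ENNReal.tsum_le_tsum fun k => ?_
  have h2 : (2⁻¹ : ℝ≥0∞) ^ k = ENNReal.ofReal (2⁻¹ ^ k) := by
    rw [ENNReal.ofReal_pow (by norm_num), ENNReal.ofReal_inv_of_pos (by norm_num)]
    simp
  rw [h2, ← ENNReal.ofReal_mul (by positivity)]
  refine ENNReal.ofReal_le_ofReal ((h.incompleteProb_le _).trans ?_)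
  rw [pow_add, mul_comm (_ ^ k), ← mul_assoc]
  gcongr

theorem ae_collectionTime_ne_top [IsProbabilityMeasure μ] (h : IsUniformGroupDrawing μ n s D)
    (hr : ((n - s : ℕ) : ℝ) / n ≤ 2⁻¹) : ∀ᵐ ω ∂μ, collectionTime D ω ≠ ⊤ := by
  have hfin : expectedCollectionTime μ D ≠ ⊤ := by
    rw [h.expectedCollectionTime_eq_tsum]
    refine ne_top_of_le_ne_top ?_ (by simpa using h.tsum_incompleteProb_add_le hr 0)
    exact ENNReal.mul_ne_top (ENNReal.natCast_ne_top n) (by simp)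
  have hmeas : Measurable fun ω => (collectionTime D ω : ℝ≥0∞) :=
    (Measurable.of_discrete (f := fun x : ℕ∞ => (x : ℝ≥0∞))).comp h.measurable_collectionTime
  filter_upwards [ae_lt_top hmeas hfin] with ω hω
  simpa [lt_top_iff_ne_top] using hω

end IsUniformGroupDrawing

end Drawing

/-! ### Limits of the tail probabilities and of the expectation -/

section Limits

variable {Ω : ℕ → Type*} [∀ n, MeasurableSpace (Ω n)] {μ : ∀ n, Measure (Ω n)}
  [∀ n, IsProbabilityMeasure (μ n)] {D : ∀ n, ℕ → Ω n → Finset (Fin n)} {s : ℕ → ℕ}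

theorem tendsto_expectedCollectionTime (hD : ∀ n, IsUniformGroupDrawing (μ n) n (s n) (D n))
    {t : ℕ} {c : ℝ}
    (hratio : Tendsto (fun n => ((n - s n : ℕ) : ℝ) / n) atTop (𝓝 0))
    (htail : Tendsto (fun n : ℕ => n * (((n - s n : ℕ) : ℝ) / n) ^ (t + 1)) atTop (𝓝 0))
    (hlt : ∀ k < t, Tendsto (fun n => incompleteProb (μ n) (D n) k) atTop (𝓝 1))
    (heq : Tendsto (fun n => incompleteProb (μ n) (D n) t) atTop (𝓝 c)) :
    Tendsto (fun n => expectedCollectionTime (μ n) (D n)) atTop (𝓝 (ENNReal.ofReal (t + c))) := by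
  have hhead : Tendsto (fun n => ENNReal.ofReal (∑ k ∈ Finset.range (t + 1),
      incompleteProb (μ n) (D n) k)) atTop (𝓝 (ENNReal.ofReal (t + c))) := by
    refine ENNReal.tendsto_ofReal ?_
    simp_rw [Finset.sum_range_succ]
    refine Tendsto.add ?_ heq
    have := tendsto_finsetSum (Finset.range t) fun k hk => hlt k (Finset.mem_range.1 hk)
    simpa using this
  have htl : Tendsto (fun n => ∑' k, ENNReal.ofReal (incompleteProb (μ n) (D n) (k + (t + 1))))
      atTop (𝓝 0) := by
    have hb := ENNReal.Tendsto.mul_const (b := 2) (ENNReal.tendsto_ofReal htail)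
      (Or.inr (by simp))
    rw [ENNReal.ofReal_zero, zero_mul] at hb
    refine tendsto_of_tendsto_of_tendsto_of_le_of_le' tendsto_const_nhds hb
      (Eventually.of_forall fun _ => zero_le) ?_
    filter_upwards [hratio.eventually_le_const (by norm_num : (0 : ℝ) < 2⁻¹)] with n hn
    exact (hD n).tsum_incompleteProb_add_le hn _
  have := hhead.add htl
  rw [add_zero] at this
  refine this.congr fun n => ?_
  rw [(hD n).expectedCollectionTime_eq_tsum,
    ENNReal.ofReal_sum_of_nonneg fun _ _ => incompleteProb_nonneg _]
  exact ENNReal.summable.sum_add_tsum_nat_add'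

/-- The second moment bound gives `1 - p_l ≤ 1/m_l`, and `p_k ≥ p_l` for `k ≤ l`. -/
theorem tendsto_incompleteProb_one (hD : ∀ n, IsUniformGroupDrawing (μ n) n (s n) (D n)) {l : ℕ}
    (hmean : Tendsto (fun n : ℕ => n * (((n - s n : ℕ) : ℝ) / n) ^ l) atTop atTop) {k : ℕ}
    (hk : k ≤ l) : Tendsto (fun n => incompleteProb (μ n) (D n) k) atTop (𝓝 1) := by
  have hlow : Tendsto (fun n : ℕ => 1 - (n * (((n - s n : ℕ) : ℝ) / n) ^ l)⁻¹) atTop (𝓝 1) := by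
    simpa using (tendsto_inv_atTop_zero.comp hmean).const_sub 1
  refine tendsto_of_tendsto_of_tendsto_of_le_of_le' hlow tendsto_const_nhds ?_
    (Eventually.of_forall fun _ => incompleteProb_le_one k)
  filter_upwards [hmean.eventually_gt_atTop 0] with n hn
  have h1 := (hD n).mean_mul_one_sub_incompleteProb_le l
  have h2 : 1 - incompleteProb (μ n) (D n) l ≤ (n * (((n - s n : ℕ) : ℝ) / n) ^ l)⁻¹ := by
    rwa [← one_div, le_div_iff₀' hn]
  have h3 := IsUniformGroupDrawing.incompleteProb_antitone (μ := μ n) (D n) hk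
  linarith

theorem tendsto_incompleteProb_zero (hD : ∀ n, IsUniformGroupDrawing (μ n) n (s n) (D n)) {l : ℕ}
    (hmean : Tendsto (fun n : ℕ => n * (((n - s n : ℕ) : ℝ) / n) ^ l) atTop (𝓝 0)) :
    Tendsto (fun n => incompleteProb (μ n) (D n) l) atTop (𝓝 0) :=
  squeeze_zero (fun _ => incompleteProb_nonneg l) (fun n => (hD n).incompleteProb_le l) hmean

/-- The inclusion–exclusion sums converge, term by term, to the exponential series. -/
theorem tendsto_alternating_sum {r : ℕ → ℕ} (hrn : ∀ n, r n ≤ n) (hr : Tendsto r atTop atTop)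
    {t : ℕ} {L : ℝ} (hmean : Tendsto (fun n : ℕ => n * ((r n : ℝ) / n) ^ t) atTop (𝓝 L)) :
    Tendsto (fun n : ℕ => ∑ j ∈ Finset.range (n + 1), (-1 : ℝ) ^ j * n.choose j *
      (((r n).descFactorial j : ℝ) / n.descFactorial j) ^ t) atTop (𝓝 (Real.exp (-L))) := by
  -- Binomials vanish for `j > n`, so the sum is a full series and dominated convergence applies.
  have hsum : ∀ n : ℕ, ∑ j ∈ Finset.range (n + 1), (-1 : ℝ) ^ j * n.choose j *
      (((r n).descFactorial j : ℝ) / n.descFactorial j) ^ t =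
      ∑' j : ℕ, (-1 : ℝ) ^ j * n.choose j *
      (((r n).descFactorial j : ℝ) / n.descFactorial j) ^ t := fun n => by
    refine (tsum_eq_sum fun j hj => ?_).symm
    rw [Nat.choose_eq_zero_of_lt (by simpa using hj)]
    simp
  simp_rw [hsum]
  rw [Real.exp_eq_exp_ℝ, NormedSpace.exp_eq_tsum_div]
  refine tendsto_tsum_of_dominated_convergence (Real.summable_pow_div_factorial (L + 1)) ?_ ?_
  · intro j
    have hdesc : Tendsto (fun m : ℕ => (m.descFactorial j : ℝ) / (m : ℝ) ^ j) atTop (𝓝 1) := by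
      refine (isEquivalent_iff_tendsto_one ?_).1 (isEquivalent_descFactorial j)
      filter_upwards [eventually_ne_atTop 0] with m hm
      positivity
    -- The `j`-th term is `(-1)^j m_t^j / j!` times corrections `(x)_j / x^j`, for `x = n` and `x =
    -- r n`, which tend to `1`.
    have hlim : Tendsto (fun n : ℕ => (-1 : ℝ) ^ j * ((n.descFactorial j : ℝ) / (n : ℝ) ^ j) *
        ((((r n).descFactorial j : ℝ) / (r n : ℝ) ^ j) /
          ((n.descFactorial j : ℝ) / (n : ℝ) ^ j)) ^ t *
        ((n * ((r n : ℝ) / n) ^ t) ^ j / (j.factorial : ℝ))) atTop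
        (𝓝 ((-1 : ℝ) ^ j * 1 * (1 / 1) ^ t * (L ^ j / (j.factorial : ℝ)))) :=
      ((hdesc.const_mul _).mul (((hdesc.comp hr).div hdesc one_ne_zero).pow t)).mul
        ((hmean.pow j).div_const _)
    have hL : (-1 : ℝ) ^ j * 1 * (1 / 1) ^ t * (L ^ j / (j.factorial : ℝ)) =
        (-L) ^ j / (j.factorial : ℝ) := by
      rw [neg_pow L j]; ring
    rw [hL] at hlim
    refine hlim.congr' ?_
    filter_upwards [eventually_ne_atTop 0, hr.eventually_ne_atTop 0, eventually_ge_atTop j]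
      with n hn hrn0 hjn
    have h1 : (n : ℝ) ≠ 0 := by exact_mod_cast hn
    have h2 : (r n : ℝ) ≠ 0 := by exact_mod_cast hrn0
    have h3 : (j.factorial : ℝ) ≠ 0 := by exact_mod_cast j.factorial_ne_zero
    have h4 : (n.choose j : ℝ) = n.descFactorial j / j.factorial := by
      rw [Nat.descFactorial_eq_factorial_mul_choose]; push_cast; field_simp
    have h5 : (n.descFactorial j : ℝ) ≠ 0 := by
      exact_mod_cast (Nat.descFactorial_pos.2 hjn).ne'
    rw [h4]
    simp only [div_pow, mul_pow]
    field_simp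
    ring
  -- Once `m_t ≤ L + 1`, the `j`-th term is at most `m_t^j / j! ≤ (L + 1)^j / j!` in absolute value.
  · filter_upwards [hmean.eventually_le_const (lt_add_one L)] with n hn j
    rcases lt_or_ge n j with hj | hj
    · rw [Nat.choose_eq_zero_of_lt hj]
      have : 0 ≤ (n : ℝ) * ((r n : ℝ) / n) ^ t := by positivity
      have : 0 ≤ L + 1 := this.trans hn
      simp only [Nat.cast_zero, mul_zero, zero_mul, norm_zero]
      positivity
    · have h1 : (n.choose j : ℝ) ≤ (n : ℝ) ^ j / j.factorial := Nat.choose_le_pow_div j n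
      have h2 := descFactorial_div_le (hrn n) hj
      rw [norm_mul, norm_mul, norm_pow, norm_neg, norm_one, one_pow, one_mul,
        Real.norm_of_nonneg (by positivity), Real.norm_of_nonneg (by positivity)]
      calc (n.choose j : ℝ) * (((r n).descFactorial j : ℝ) / n.descFactorial j) ^ t
          ≤ ((n : ℝ) ^ j / j.factorial) * (((r n : ℝ) / n) ^ j) ^ t := by gcongr
        _ = ((n : ℝ) * ((r n : ℝ) / n) ^ t) ^ j / j.factorial := by ring
        _ ≤ (L + 1) ^ j / j.factorial := by gcongr

theorem tendsto_incompleteProb_poisson (hD : ∀ n, IsUniformGroupDrawing (μ n) n (s n) (D n))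
    (hr : Tendsto (fun n => n - s n) atTop atTop) {t : ℕ} {L : ℝ}
    (hmean : Tendsto (fun n : ℕ => n * (((n - s n : ℕ) : ℝ) / n) ^ t) atTop (𝓝 L)) :
    Tendsto (fun n => incompleteProb (μ n) (D n) t) atTop (𝓝 (1 - Real.exp (-L))) := by
  have := (tendsto_alternating_sum (fun n => Nat.sub_le n (s n)) hr hmean).const_sub 1
  refine this.congr fun n => ?_
  rw [← (hD n).one_sub_incompleteProb t]
  ring

end Limits

/-! ### Convergence in distribution to a two-point law -/

theorem abs_integral_sub_atoms_le (P : Measure ℝ) [IsProbabilityMeasure P] {a b : ℝ} (hab : a ≠ b)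
    (f : BoundedContinuousFunction ℝ ℝ) :
    |∫ x, f x ∂P - (P.real {a} * f a + P.real {b} * f b)| ≤
      ‖f‖ * (1 - (P.real {a} + P.real {b})) := by
  have hf : Integrable f P := f.integrable P
  have hdisj : Disjoint ({a} : Set ℝ) {b} := by simpa using hab
  have hm : MeasurableSet ({a} ∪ {b} : Set ℝ) := by measurability
  have h1 : ∫ x in ({a} ∪ {b} : Set ℝ), f x ∂P = P.real {a} * f a + P.real {b} * f b := by
    rw [setIntegral_union hdisj (measurableSet_singleton b) hf.integrableOn hf.integrableOn,
      integral_singleton, integral_singleton, smul_eq_mul, smul_eq_mul]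
  have h2 : P.real ({a} ∪ {b} : Set ℝ)ᶜ = 1 - (P.real {a} + P.real {b}) := by
    rw [probReal_compl_eq_one_sub hm, measureReal_union hdisj (measurableSet_singleton b)]
  rw [← h1, ← h2, ← integral_add_compl hm hf, add_sub_cancel_left, ← Real.norm_eq_abs]
  exact norm_setIntegral_le_of_norm_le_const (measure_lt_top _ _) fun x _ => f.norm_coe_le_norm x

/-- Weak convergence to a two-point law follows from convergence of the masses of the points. -/
theorem tendsto_of_tendsto_two_atoms {ι : Type*} {l : Filter ι} {P : ι → ProbabilityMeasure ℝ}
    {Q : ProbabilityMeasure ℝ} {a b p : ℝ} (hab : a ≠ b)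
    (hQa : (Q : Measure ℝ).real {a} = p) (hQb : (Q : Measure ℝ).real {b} = 1 - p)
    (hPa : Tendsto (fun i => (P i : Measure ℝ).real {a}) l (𝓝 p))
    (hPb : Tendsto (fun i => (P i : Measure ℝ).real {b}) l (𝓝 (1 - p))) :
    Tendsto P l (𝓝 Q) := by
  rw [ProbabilityMeasure.tendsto_iff_forall_integral_tendsto]
  intro f
  have hQ : ∫ x, f x ∂(Q : Measure ℝ) = p * f a + (1 - p) * f b := by
    have := abs_integral_sub_atoms_le (Q : Measure ℝ) hab f
    rw [hQa, hQb, add_sub_cancel, sub_self, mul_zero] at this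
    linarith [abs_nonpos_iff.1 this]
  have hmain := (hPa.mul_const (f a)).add (hPb.mul_const (f b))
  have hrem := ((hPa.add hPb).const_sub 1).const_mul ‖f‖
  rw [add_sub_cancel, sub_self, mul_zero] at hrem
  have herr : Tendsto (fun i => ∫ x, f x ∂(P i : Measure ℝ) -
      ((P i : Measure ℝ).real {a} * f a + (P i : Measure ℝ).real {b} * f b)) l (𝓝 0) :=
    squeeze_zero_norm (fun i => abs_integral_sub_atoms_le (P i : Measure ℝ) hab f) hrem
  rw [hQ]
  simpa using herr.add hmain

/-- `{Y = k + 1}` is `{Y > k}` minus `{Y > k + 1}`. The value `k + 1` is positive, so the default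
`0` taken where `Y = ⊤` does not interfere. -/
theorem measureReal_realCollectionTime_eq {Ω : Type*} [MeasurableSpace Ω] {μ : Measure Ω}
    [IsProbabilityMeasure μ] {n s : ℕ} {D : ℕ → Ω → Finset (Fin n)}
    (h : IsUniformGroupDrawing μ n s D) (k : ℕ) :
    μ.real {ω | realCollectionTime D ω = (k : ℝ) + 1} =
      incompleteProb μ D k - incompleteProb μ D (k + 1) := by
  rw [incompleteProb, incompleteProb, ← measureReal_sdiff]
  · congr 1
    ext ω
    simp only [realCollectionTime, Set.mem_ofPred_eq, Set.mem_sdiff, not_lt]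
    generalize collectionTime D ω = y
    induction y using ENat.recTopCoe with
    | top =>
      simp only [ENat.toNat_top, Nat.cast_zero, top_le_iff]
      constructor
      · intro h0
        have : (0 : ℝ) ≤ k := k.cast_nonneg
        linarith
      · rintro ⟨-, h0⟩
        exact absurd h0 (ENat.natCast_ne_top _)
    | coe m =>
      rw [ENat.toNat_natCast]
      norm_cast
      omega
  · intro ω (hω : ((k + 1 : ℕ) : ℕ∞) < _)
    exact lt_trans (by exact_mod_cast Nat.lt_succ_self k) hω
  · exact h.measurableSet_lt_collectionTime _

/-! ### Growth rates of `n - s` -/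

section Asymptotics

/-- This explains the critical exponent: `m_t` is of constant order exactly when `r` is of order
`n^((t-1)/t)`. -/
theorem mul_div_pow_eq_div_rpow_pow {t n : ℕ} (ht : t ≠ 0) (hn : n ≠ 0) (r : ℝ) :
    n * (r / n) ^ t = (r / (n : ℝ) ^ (((t : ℝ) - 1) / t)) ^ t := by
  have hn' : 0 < (n : ℝ) := by positivity
  have ht' : (t : ℝ) ≠ 0 := by exact_mod_cast ht
  have hx : ((n : ℝ) ^ (((t : ℝ) - 1) / t)) ^ t = (n : ℝ) ^ t / n := by
    rw [← Real.rpow_mul_natCast hn'.le, div_mul_cancel₀ _ ht', Real.rpow_sub_one hn'.ne',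
      Real.rpow_natCast]
  rw [div_pow, div_pow, hx]
  field_simp

theorem tendsto_div_of_tendsto_div_rpow {r : ℕ → ℝ} {a L : ℝ} (ha : a < 1)
    (h : Tendsto (fun n : ℕ => r n / (n : ℝ) ^ a) atTop (𝓝 L)) :
    Tendsto (fun n : ℕ => r n / n) atTop (𝓝 0) := by
  have h1 : Tendsto (fun n : ℕ => (n : ℝ) ^ (-(1 - a))) atTop (𝓝 0) :=
    (tendsto_rpow_neg_atTop (by linarith)).comp tendsto_natCast_atTop_atTop
  have := h.mul h1
  rw [mul_zero] at this
  refine this.congr' ?_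
  filter_upwards [eventually_gt_atTop 0] with n hn
  have hn' : 0 < (n : ℝ) := by exact_mod_cast hn
  rw [neg_sub, Real.rpow_sub_one hn'.ne']
  have := (Real.rpow_pos_of_pos hn' a).ne'
  field_simp

theorem tendsto_natCast_rpow_atTop {a : ℝ} (ha : 0 < a) :
    Tendsto (fun n : ℕ => (n : ℝ) ^ a) atTop atTop :=
  (tendsto_rpow_atTop ha).comp tendsto_natCast_atTop_atTop

theorem tendsto_div_rpow_of_abs_sub_le {r : ℕ → ℝ} {a L C : ℝ} (ha : 0 < a)
    (h : ∀ᶠ n : ℕ in atTop, |r n - L * (n : ℝ) ^ a| ≤ C) :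
    Tendsto (fun n : ℕ => r n / (n : ℝ) ^ a) atTop (𝓝 L) := by
  rw [tendsto_iff_norm_sub_tendsto_zero]
  have hlim : Tendsto (fun n : ℕ => C / (n : ℝ) ^ a) atTop (𝓝 0) :=
    (tendsto_natCast_rpow_atTop ha).const_div_atTop C
  refine squeeze_zero' (Eventually.of_forall fun _ => norm_nonneg _) ?_ hlim
  filter_upwards [h, eventually_gt_atTop 0] with n hn hn0
  have hpos : 0 < (n : ℝ) ^ a := Real.rpow_pos_of_pos (by exact_mod_cast hn0) a
  rw [Real.norm_eq_abs, div_sub' hpos.ne', abs_div, abs_of_pos hpos, mul_comm _ L]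
  gcongr

end Asymptotics

/-! ### The main theorem -/

theorem theorem3 (t : ℕ) (ht : 2 ≤ t) (s : ℕ → ℕ)
    {Ω : ℕ → Type*} [∀ n, MeasurableSpace (Ω n)]
    (μ : ∀ n, Measure (Ω n)) [∀ n, IsProbabilityMeasure (μ n)]
    (D : ∀ n, ℕ → Ω n → Finset (Fin n))
    (hD : ∀ n, IsUniformGroupDrawing (μ n) n (s n) (D n)) :
    -- (a), for every way of rounding `n - lam * n ^ ((t - 1) / t)` to an integer
    (∀ lam : ℝ, 0 < lam →
      (∀ᶠ n : ℕ in atTop,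
        |(s n : ℝ) - ((n : ℝ) - lam * (n : ℝ) ^ (((t : ℝ) - 1) / (t : ℝ)))| ≤ 1) →
      (∀ᶠ n in atTop, ∀ᵐ ω ∂(μ n), collectionTime (D n) ω ≠ ⊤) ∧
      Tendsto (fun n => expectedCollectionTime (μ n) (D n)) atTop
        (𝓝 (ENNReal.ofReal ((t : ℝ) * Real.exp (-(lam ^ t))
          + ((t : ℝ) + 1) * (1 - Real.exp (-(lam ^ t)))))) ∧
      ∀ {Ω' : Type*} [MeasurableSpace Ω'] (ν : Measure Ω') [IsProbabilityMeasure ν] (Z : Ω' → ℝ),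
        AEMeasurable Z ν →
        ν {x | Z x = (t : ℝ)} = ENNReal.ofReal (Real.exp (-(lam ^ t))) →
        ν {x | Z x = (t : ℝ) + 1} = ENNReal.ofReal (1 - Real.exp (-(lam ^ t))) →
        TendstoInDistribution (fun n => realCollectionTime (D n)) atTop Z μ ν) ∧
    -- (b)
    ((fun n : ℕ => (n : ℝ) - (s n : ℝ)) =o[atTop]
        (fun n : ℕ => (n : ℝ) ^ ((t : ℝ) / ((t : ℝ) + 1))) →
      Tendsto (fun n : ℕ => ((n : ℝ) - (s n : ℝ)) / (n : ℝ) ^ (((t : ℝ) - 1) / (t : ℝ)))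
        atTop atTop →
      (∀ᶠ n in atTop, ∀ᵐ ω ∂(μ n), collectionTime (D n) ω ≠ ⊤) ∧
      Tendsto (fun n => expectedCollectionTime (μ n) (D n)) atTop (𝓝 ((t : ℝ≥0∞) + 1)) ∧
      ∀ ε : ℝ, 0 < ε →
        Tendsto (fun n => μ n {ω | ε < |realCollectionTime (D n) ω - ((t : ℝ) + 1)|})
          atTop (𝓝 0)) := by
  have hcast : ∀ n, ((n - s n : ℕ) : ℝ) = (n : ℝ) - s n := fun n => Nat.cast_sub (hD n).card_le
  have ht0 : t ≠ 0 := by omega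
  have ht2 : (2 : ℝ) ≤ t := by exact_mod_cast ht
  have ha0 : 0 < ((t : ℝ) - 1) / t := by apply div_pos <;> linarith
  have ha1 : ((t : ℝ) - 1) / t < 1 := by rw [div_lt_one] <;> linarith
  have hfinite : Tendsto (fun n => ((n - s n : ℕ) : ℝ) / n) atTop (𝓝 0) →
      ∀ᶠ n in atTop, ∀ᵐ ω ∂(μ n), collectionTime (D n) ω ≠ ⊤ := fun h => by
    filter_upwards [h.eventually_le_const (by norm_num : (0 : ℝ) < 2⁻¹)] with n hn
    exact (hD n).ae_collectionTime_ne_top hn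
  refine ⟨fun lam hlam hs => ?_, fun hsmall hlarge => ?_⟩
  · have hx : Tendsto (fun n : ℕ => ((n - s n : ℕ) : ℝ) / (n : ℝ) ^ (((t : ℝ) - 1) / t)) atTop
        (𝓝 lam) := by
      refine tendsto_div_rpow_of_abs_sub_le (C := 1) ha0 (hs.mono fun n hn => ?_)
      rw [hcast, abs_sub_comm]
      convert hn using 2
      ring
    have hratio := tendsto_div_of_tendsto_div_rpow ha1 hx
    have hr : Tendsto (fun n => n - s n) atTop atTop := by
      rw [← tendsto_natCast_atTop_iff (R := ℝ)]
      refine (hx.pos_mul_atTop hlam (tendsto_natCast_rpow_atTop ha0)).congr' ?_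
      filter_upwards [eventually_gt_atTop 0] with n hn
      exact div_mul_cancel₀ _ (Real.rpow_pos_of_pos (by exact_mod_cast hn) _).ne'
    have hmean : Tendsto (fun n : ℕ => n * (((n - s n : ℕ) : ℝ) / n) ^ t) atTop
        (𝓝 (lam ^ t)) := by
      refine (hx.pow t).congr' ?_
      filter_upwards [eventually_ne_atTop 0] with n hn
      exact (mul_div_pow_eq_div_rpow_pow ht0 hn _).symm
    have htail : Tendsto (fun n : ℕ => n * (((n - s n : ℕ) : ℝ) / n) ^ (t + 1)) atTop (𝓝 0) := by
      have := hmean.mul hratio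
      rw [mul_zero] at this
      exact this.congr fun n => by ring
    -- `m_{t-1} = m_t (r/n)⁻¹`, where `m_t` has a positive limit and `r/n` tends to `0` from above.
    have hpred : Tendsto (fun n : ℕ => n * (((n - s n : ℕ) : ℝ) / n) ^ (t - 1)) atTop atTop := by
      have hpos : ∀ᶠ n : ℕ in atTop, 0 < ((n - s n : ℕ) : ℝ) / n := by
        filter_upwards [hr.eventually_gt_atTop 0, eventually_gt_atTop 0] with n h1 h2
        have : (0 : ℝ) < (n - s n : ℕ) := by exact_mod_cast h1
        positivity
      have hinv : Tendsto (fun n : ℕ => (((n - s n : ℕ) : ℝ) / n)⁻¹) atTop atTop :=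
        tendsto_inv_nhdsGT_zero.comp (tendsto_nhdsWithin_iff.2 ⟨hratio, hpos⟩)
      refine (hmean.pos_mul_atTop (by positivity) hinv).congr' ?_
      filter_upwards [hpos] with n hn
      obtain ⟨u, rfl⟩ : ∃ u, t = u + 1 := ⟨t - 1, by omega⟩
      rw [pow_succ, ← mul_assoc, mul_inv_cancel_right₀ hn.ne', Nat.add_sub_cancel]
    have hone : ∀ k < t, Tendsto (fun n => incompleteProb (μ n) (D n) k) atTop (𝓝 1) :=
      fun k hk => tendsto_incompleteProb_one hD hpred (by omega)
    have hpoisson := tendsto_incompleteProb_poisson hD hr hmean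
    have hzero := tendsto_incompleteProb_zero hD htail
    refine ⟨hfinite hratio, ?_, fun ν _ Z hZ hZt hZt1 => ⟨fun n =>
      (hD n).measurable_realCollectionTime.aemeasurable, hZ, ?_⟩⟩
    · have := tendsto_expectedCollectionTime hD hratio htail hone hpoisson
      convert this using 3
      ring
    · have hexp : Real.exp (-lam ^ t) ≤ 1 := Real.exp_le_one_iff.2 (by simp; positivity)
      refine tendsto_of_tendsto_two_atoms (a := t) (b := t + 1) (p := Real.exp (-lam ^ t))
        (by simp) ?_ ?_ ?_ ?_
      · rw [ProbabilityMeasure.coe_mk, Measure.real, Measure.map_apply_of_aemeasurable hZ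
          (measurableSet_singleton _)]
        exact (congrArg ENNReal.toReal hZt).trans (ENNReal.toReal_ofReal (Real.exp_nonneg _))
      · rw [ProbabilityMeasure.coe_mk, Measure.real, Measure.map_apply_of_aemeasurable hZ
          (measurableSet_singleton _)]
        exact (congrArg ENNReal.toReal hZt1).trans (ENNReal.toReal_ofReal (by linarith))
      -- `P[Y = t] = p_{t-1} - p_t → 1 - (1 - exp (-λ^t))`.
      · have hlim := (hone (t - 1) (by omega)).sub hpoisson
        rw [sub_sub_cancel] at hlim
        refine hlim.congr fun n => ?_
        have := measureReal_realCollectionTime_eq (hD n) (t - 1)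
        rw [Nat.sub_add_cancel (by omega), Nat.cast_sub (by omega), Nat.cast_one,
          sub_add_cancel] at this
        rw [ProbabilityMeasure.coe_mk, map_measureReal_apply
          (hD n).measurable_realCollectionTime (measurableSet_singleton _)]
        exact this.symm
      · have hlim := hpoisson.sub hzero
        rw [sub_zero] at hlim
        refine hlim.congr fun n => ?_
        rw [ProbabilityMeasure.coe_mk, map_measureReal_apply
          (hD n).measurable_realCollectionTime (measurableSet_singleton _)]
        exact (measureReal_realCollectionTime_eq (hD n) t).symm
  -- The exponent `t/(t+1)` is the critical one for `t + 1`, so it is written as `((t+1) -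
  -- 1)/(t+1)`.
  · have hx : Tendsto (fun n : ℕ => ((n - s n : ℕ) : ℝ) /
        (n : ℝ) ^ ((((t + 1 : ℕ) : ℝ) - 1) / (t + 1 : ℕ))) atTop (𝓝 0) := by
      refine hsmall.tendsto_div_nhds_zero.congr fun n => ?_
      rw [hcast, Nat.cast_add, Nat.cast_one, add_sub_cancel_right]
    have hratio := tendsto_div_of_tendsto_div_rpow
      (by rw [div_lt_one] <;> push_cast <;> linarith) hx
    have htail : Tendsto (fun n : ℕ => n * (((n - s n : ℕ) : ℝ) / n) ^ (t + 1)) atTop (𝓝 0) := by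
      have := hx.pow (t + 1)
      rw [zero_pow (Nat.succ_ne_zero t)] at this
      refine this.congr' ?_
      filter_upwards [eventually_ne_atTop 0] with n hn
      exact (mul_div_pow_eq_div_rpow_pow (Nat.succ_ne_zero t) hn _).symm
    have hmean : Tendsto (fun n : ℕ => n * (((n - s n : ℕ) : ℝ) / n) ^ t) atTop atTop := by
      refine ((tendsto_pow_atTop ht0).comp hlarge).congr' ?_
      filter_upwards [eventually_ne_atTop 0] with n hn
      rw [mul_div_pow_eq_div_rpow_pow ht0 hn, hcast]
      rfl
    have hone : ∀ k ≤ t, Tendsto (fun n => incompleteProb (μ n) (D n) k) atTop (𝓝 1) :=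
      fun k hk => tendsto_incompleteProb_one hD hmean hk
    have hzero := tendsto_incompleteProb_zero hD htail
    refine ⟨hfinite hratio, ?_, fun ε hε => ?_⟩
    · have := tendsto_expectedCollectionTime hD hratio htail (fun k hk => hone k hk.le)
        (hone t le_rfl)
      rwa [ENNReal.ofReal_add (Nat.cast_nonneg t) zero_le_one, ENNReal.ofReal_natCast,
        ENNReal.ofReal_one] at this
    -- The deviation event lies in `{Y ≠ t + 1}`, of probability `1 - (p_t - p_{t+1}) → 0`.
    · have hlim := ENNReal.tendsto_ofReal (((hone t le_rfl).sub hzero).const_sub 1)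
      rw [sub_zero, sub_self, ENNReal.ofReal_zero] at hlim
      refine tendsto_of_tendsto_of_tendsto_of_le_of_le tendsto_const_nhds hlim
        (fun _ => zero_le) fun n => ?_
      have hms : MeasurableSet {ω | realCollectionTime (D n) ω = (t : ℝ) + 1} :=
        (hD n).measurable_realCollectionTime (measurableSet_singleton _)
      beta_reduce
      rw [← measureReal_realCollectionTime_eq (hD n) t, ← probReal_compl_eq_one_sub hms,
        ofReal_measureReal]
      refine measure_mono fun ω hω hωt => ?_
      have h1 : ε < |realCollectionTime (D n) ω - ((t : ℝ) + 1)| := hω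
      rw [show realCollectionTime (D n) ω = (t : ℝ) + 1 from hωt, sub_self, abs_zero] at h1
      exact absurd h1 hε.le.not_gt
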